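/- Let $B$ be the closed Euclidean unit ball of $\mathbb R^d$. In each round $t=1,\dots,T$ a randomized algorithm, having seen the loss functions $f_1,\dots,f_{t-1}$, chooses $k$ points $x_{t,1},\dots,x_{t,k}\in B$ (using its internal randomness); then a loss function $f_t$ is revealed and the algorithm pays $\min_{1\le j\le k} f_t(x_{t,j})$. Its regret is $$\sum_{t=1}^T \min_{1\le j\le k} f_t(x_{t,j})-\min_{x^1,\dots,x^k\in B}\ \sum_{t=1}^T\min_{1\le j\le k} f_t(x^j).$$ A $k$-means loss of scale $a>0$ is a function $f(x)=a\|x-y\|^2$ with centre $y\in B$ (for $a=1/4$ it is $1$-Lipschitz on $B$). There is a universal constant $c>0$ such that for all integers $k\ge 2$, $d\ge 6$, $T\ge k$ and every $a>0$ the following two statements hold. 1. (Known stochastic adversary.) There is a finitely supported probability distribution $\mu$ on $B$ such that every randomized algorithm, even one designed with knowledge of $\mu$, $T$ and $a$, has expected regret at least $c\,a\,k^{-2/(d-1)}\sqrt{kT}$ when $f_t(x)=a\|x-y_t\|^2$ and the centres $y_1,\dots,y_T$ are drawn independently from $\mu$, independently of the randomness of the algorithm; the expectation is over the centres and the algorithm.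 2. (Worst case.) For every randomized algorithm there is a fixed sequence $y_1,\dots,y_T\in B$ such that its expected regret on the losses $f_t(x)=a\|x-y_t\|^2$ is at least $c\,a\,k^{-2/(d-1)}\sqrt{kT}$. Consequently, strong convexity does not give logarithmic regret: for all $k\ge2$ and $d\ge6$ there are no randomized algorithms $(A_T)_{T\ge1}$ and constants $C,T_0$ such that for every $T\ge T_0$ the algorithm $A_T$ has expected regret at most $C\log T$ on every sequence of $T$ losses that are $1$-Lipschitz and $\tfrac12$-strongly convex on $B$. -/

import Mathlib

open MeasureTheory

universe u

namespace TopK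

/-- The space `ℝ^d` with its Euclidean norm. -/
abbrev Space (d : ℕ) : Type := EuclideanSpace ℝ (Fin d)

/-- The closed Euclidean unit ball of `ℝ^d`, the set of admissible actions. -/
def unitBall (d : ℕ) : Set (Space d) := Metric.closedBall 0 1

/-- A loss function. Its values matter only on the unit ball. -/
abbrev Loss (d : ℕ) : Type := Space d → ℝ

/-- The `k`-means loss with scale `a` and centre `y`: `x ↦ a * ‖x - y‖ ^ 2`. -/
noncomputable def kMeansLoss {d : ℕ} (a : ℝ) (y : Space d) : Loss d :=
  fun x => a * ‖x - y‖ ^ 2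

/-- The loss of a `k`-tuple of actions: the smallest of the `k` losses. -/
noncomputable def topLoss {d k : ℕ} (f : Loss d) (x : Fin k → Space d) : ℝ :=
  ⨅ j, f (x j)

/-- A randomized online algorithm that plays `k` points of the unit ball of `ℝ^d` in each round.
All its internal randomness is a sample `ω` drawn from `P`. In the round with index `t` (rounds are
numbered from `0`) it has seen the `t` earlier loss functions and then chooses its `k` points.
The choice need only be measurable in `ω`. -/
structure RandomizedAlgorithm (d k : ℕ) where
  Ω : Type u
  [measurableSpace : MeasurableSpace Ω]
  P : Measure Ω
  [isProbabilityMeasure : IsProbabilityMeasure P]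
  action : (t : ℕ) → (Fin t → Loss d) → Ω → Fin k → Space d
  action_mem : ∀ t h ω j, action t h ω j ∈ unitBall d
  measurable_action : ∀ t h j, Measurable fun ω => action t h ω j

attribute [instance] RandomizedAlgorithm.measurableSpace
attribute [instance] RandomizedAlgorithm.isProbabilityMeasure

/-- The loss functions revealed before round `t`. -/
def history {d T : ℕ} (f : Fin T → Loss d) (t : Fin T) : Fin (t : ℕ) → Loss d :=
  fun s => f (Fin.castLE t.isLt.le s)

/-- The total loss of the best fixed `k`-tuple of points of the unit ball in hindsight. -/
noncomputable def bestStaticLoss {d T : ℕ} (k : ℕ) (f : Fin T → Loss d) : ℝ :=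
  ⨅ x : Fin k → unitBall d, ∑ t, topLoss (f t) fun j => (x j : Space d)

/-- The regret of the algorithm on the loss sequence `f`, when its internal randomness is `ω`. -/
noncomputable def RandomizedAlgorithm.regret {d k T : ℕ} (A : RandomizedAlgorithm.{u} d k)
    (f : Fin T → Loss d) (ω : A.Ω) : ℝ :=
  (∑ t : Fin T, topLoss (f t) (A.action t (history f t) ω)) - bestStaticLoss k f

/-- The expected regret on a fixed loss sequence. -/
noncomputable def RandomizedAlgorithm.expectedRegret {d k T : ℕ} (A : RandomizedAlgorithm.{u} d k)
    (f : Fin T → Loss d) : ℝ :=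
  ∫ ω, A.regret f ω ∂A.P

/-- The expected regret over `T` rounds when the losses are `k`-means losses of scale `a` whose
centres are drawn independently from `μ`, independently of the randomness of the algorithm. -/
noncomputable def RandomizedAlgorithm.stochasticRegret {d k : ℕ} (A : RandomizedAlgorithm.{u} d k)
    (T : ℕ) (a : ℝ) (μ : Measure (Space d)) : ℝ :=
  ∫ y : Fin T → Space d, A.expectedRegret (fun t => kMeansLoss a (y t)) ∂Measure.pi fun _ => μ

end TopK

namespace TopK

open scoped BigOperators

/-! Write `k = 2m + e` with `e ≤ 1`. The adversary draws centres uniformly from `M = 3m + e` points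
with pairwise distances at least `δ`: `m` collinear triples of spacing `δ`, and `e` single points. A
packing argument allows `δ` of order `k ^ (-1/(d-1))`.

The next centre is independent of the history, so each round costs any algorithm at least the
average cost of `k` actions over the `M` points. This is at least `a * m * δ² / (2M)`
(`le_sum_topLoss`).

In hindsight, each triple gets two actions: one at an end, one at the midpoint of the other two
points. Either choice of end has the same mean cost, and summed over triples it equals the
algorithm's lower bound. Choosing the more frequent end saves `a * δ² / 8` times the absolute
difference of the two end counts. This difference is a centred random walk of variance `2T/M`, so
its mean absolute value is at least `√(2T/M) / 2` (`sqrt_le_expect_abs_sum`). Summing over `m`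
triples gives regret of order `a * δ² * √(kT)`. -/

/-! ### Packing separated triples into the ball. -/

/-- Greedy choice: by volume, `n` balls of radius `r` cannot cover the ball of radius `R` when `(n +
1) * r ^ d ≤ R ^ d`. -/
theorem exists_separated_centres {d : ℕ} (hd : 0 < d) {r R : ℝ} (hr : 0 < r) (hR : 0 < R) :
    ∀ n : ℕ, (n : ℝ) * r ^ d ≤ R ^ d → ∃ z : Fin n → Space d,
      (∀ i, ‖z i‖ ≤ R) ∧ ∀ i j, i ≠ j → r ≤ dist (z i) (z j) := by
  intro n
  induction n with
  | zero => exact fun _ => ⟨Fin.elim0, fun i => i.elim0, fun i => i.elim0⟩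
  | succ n ih =>
    intro h
    have hrd : 0 < r ^ d := pow_pos hr d
    push_cast at h
    obtain ⟨z, hz, hzs⟩ := ih (by nlinarith)
    obtain ⟨w, hw, hws⟩ : ∃ w ∈ Metric.closedBall (0 : Space d) R,
        w ∉ ⋃ i, Metric.ball (z i) r := by
      by_contra! hcover
      have : Nonempty (Fin d) := ⟨⟨0, hd⟩⟩
      have hvol : (volume : Measure (Space d)) (Metric.closedBall 0 R)
          ≤ ∑ i : Fin n, volume (Metric.ball (z i) r) := by
        refine (measure_mono hcover).trans ((measure_iUnion_le _).trans ?_)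
        rw [tsum_fintype]
      simp only [Measure.addHaar_closedBall _ _ hR.le, Measure.addHaar_ball _ _ hr.le,
        finrank_euclideanSpace, Fintype.card_fin, Finset.sum_const, Finset.card_univ,
        nsmul_eq_mul] at hvol
      rw [← mul_assoc] at hvol
      have hle := (ENNReal.mul_le_mul_iff_left
        (Metric.measure_ball_pos volume (0 : Space d) one_pos).ne'
        measure_ball_lt_top.ne).1 hvol
      rw [← ENNReal.ofReal_natCast, ← ENNReal.ofReal_mul (Nat.cast_nonneg n),
        ENNReal.ofReal_le_ofReal_iff (by positivity)] at hle
      nlinarith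
    have hw' : ∀ i, r ≤ dist w (z i) := by
      simpa [Set.mem_iUnion, Metric.mem_ball, not_exists, not_lt] using hws
    refine ⟨Fin.cons w z, fun i => ?_, fun i j hij => ?_⟩
    · refine Fin.cases ?_ (fun i => ?_) i
      · simpa using hw
      · simpa using hz i
    · induction i using Fin.cases with
      | zero =>
        induction j using Fin.cases with
        | zero => exact absurd rfl hij
        | succ j => simpa using hw' j
      | succ i =>
        induction j using Fin.cases with
        | zero => simpa [dist_comm] using hw' i
        | succ j => simpa using hzs i j fun h => hij (congrArg Fin.succ h)

/-- Labels of `m` collinear triples of points and `e` single points. -/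
abbrev Label (m e : ℕ) : Type := (Fin m × Fin 3) ⊕ Fin e

theorem exists_separated_triples {d m e : ℕ} (hd : 0 < d) {δ : ℝ} (hδ : 0 < δ) (hδ' : δ < 1)
    (h : ((m + e : ℕ) : ℝ) * (3 * δ) ^ d ≤ (1 - δ) ^ d) :
    ∃ p : Label m e → Space d, (∀ c, p c ∈ unitBall d) ∧
      (∀ b c, b ≠ c → δ ≤ dist (p b) (p c)) ∧
      ∀ g, dist (p (.inl (g, 0))) (p (.inl (g, 1))) = δ ∧
        dist (p (.inl (g, 1))) (p (.inl (g, 2))) = δ := by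
  obtain ⟨z, hz, hzs⟩ := exists_separated_centres hd (by positivity : 0 < 3 * δ)
    (sub_pos.2 hδ') _ h
  let v : Space d := EuclideanSpace.single ⟨0, hd⟩ 1
  have hv : ‖v‖ = 1 := by simp [v]
  -- Offsets `-1, 0, 1` along `v`, in units of `δ`. Hosts `3δ` apart stay `δ` apart after two shifts
  -- of length at most `δ`.
  let s : Label m e → ℝ := Sum.elim (fun c => ((c.2 : ℕ) : ℝ) - 1) 0
  let q : Label m e → Fin (m + e) := fun c => finSumFinEquiv (c.map Prod.fst id)
  have hs : ∀ c, |s c| ≤ 1 := by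
    rintro (⟨g, j⟩ | c)
    · fin_cases j <;> norm_num [s]
    · simp [s]
  refine ⟨fun c => z (q c) + (s c * δ) • v, fun c => ?_, fun b c hbc => ?_, fun g => ?_⟩
  · have h1 : ‖(s c * δ) • v‖ ≤ δ := by
      rw [norm_smul, hv, mul_one, Real.norm_eq_abs, abs_mul, abs_of_pos hδ]
      exact mul_le_of_le_one_left hδ.le (hs c)
    simp only [unitBall, mem_closedBall_zero_iff]
    linarith [norm_add_le (z (q c)) ((s c * δ) • v), hz (q c)]
  · by_cases hq : q b = q c
    · have hsbc : 1 ≤ |s b - s c| := by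
        rcases b with ⟨g, i⟩ | b <;> rcases c with ⟨g', j⟩ | c
        · have hg : g = g' := by simpa [q] using hq
          subst hg
          have hij : i ≠ j := fun hij => hbc (by rw [hij])
          fin_cases i <;> fin_cases j <;> first | exact absurd rfl hij | norm_num [s]
        · simp only [q, EmbeddingLike.apply_eq_iff_eq, Sum.map_inl, Sum.map_inr, reduceCtorEq] at hq
        · simp only [q, EmbeddingLike.apply_eq_iff_eq, Sum.map_inl, Sum.map_inr, reduceCtorEq] at hq
        · simp only [q, EmbeddingLike.apply_eq_iff_eq, Sum.map_inr, id, Sum.inr.injEq] at hq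
          exact absurd (by rw [hq]) hbc
      simp only [dist_eq_norm]
      rw [hq, add_sub_add_left_eq_sub, ← sub_smul, norm_smul, hv, mul_one,
        ← sub_mul, Real.norm_eq_abs, abs_mul, abs_of_pos hδ]
      exact le_mul_of_one_le_left hδ.le hsbc
    · have h1 := hzs _ _ hq
      have h2 : ‖(s b * δ) • v - (s c * δ) • v‖ ≤ 2 * δ := by
        rw [← sub_smul, norm_smul, hv, mul_one, ← sub_mul, Real.norm_eq_abs, abs_mul,
          abs_of_pos hδ]
        refine mul_le_mul_of_nonneg_right ?_ hδ.le
        linarith [abs_sub (s b) (s c), hs b, hs c]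
      rw [dist_eq_norm] at h1 ⊢
      have h3 := norm_sub_norm_le (z (q b) - z (q c)) (-((s b * δ) • v - (s c * δ) • v))
      rw [norm_neg, sub_neg_eq_add] at h3
      have h4 : z (q b) - z (q c) + ((s b * δ) • v - (s c * δ) • v) =
        z (q b) + (s b * δ) • v - (z (q c) + (s c * δ) • v) := by abel
      rw [h4] at h3
      linarith
  · have hq : ∀ i j : Fin 3, q (.inl (g, i)) = q (.inl (g, j)) := fun i j => rfl
    constructor
    · simp only [dist_eq_norm]
      rw [hq 0 1, add_sub_add_left_eq_sub, ← sub_smul, norm_smul, hv]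
      simp [s, abs_of_pos hδ]
    · simp only [dist_eq_norm]
      rw [hq 1 2, add_sub_add_left_eq_sub, ← sub_smul, norm_smul, hv]
      norm_num [s, abs_of_pos hδ]

/-! ### Cost of `k` actions on a separated set. -/

/-- The sum of squared pairwise distances is `2 * S.card` times the right side, minus twice the
square of a norm. -/
theorem card_sub_one_mul_le_sum_dist_sq {ι E : Type*} [NormedAddCommGroup E]
    [InnerProductSpace ℝ E] {p : ι → E} {δ : ℝ} (hδ : 0 ≤ δ)
    (hp : ∀ b c, b ≠ c → δ ≤ dist (p b) (p c)) (S : Finset ι) (x : E) :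
    ((S.card : ℝ) - 1) * (δ ^ 2 / 2) ≤ ∑ c ∈ S, ‖x - p c‖ ^ 2 := by
  classical
  rcases S.eq_empty_or_nonempty with rfl | hS
  · simp; positivity
  have hcard : (0 : ℝ) < S.card := by exact_mod_cast hS.card_pos
  have hexpand : ∑ b ∈ S, ∑ c ∈ S, ‖p b - p c‖ ^ 2
      = 2 * S.card * ∑ c ∈ S, ‖x - p c‖ ^ 2 - 2 * ‖∑ c ∈ S, (x - p c)‖ ^ 2 := by
    have h1 : ∀ b c, ‖p b - p c‖ ^ 2
        = ‖x - p b‖ ^ 2 + ‖x - p c‖ ^ 2 - 2 * inner ℝ (x - p b) (x - p c) := by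
      intro b c
      rw [← norm_sub_rev, show p c - p b = (x - p b) - (x - p c) by abel, norm_sub_sq_real]
      ring
    rw [← real_inner_self_eq_norm_sq, sum_inner]
    simp only [inner_sum]
    generalize hI : (fun b c => inner ℝ (x - p b) (x - p c)) = I
    have hI' : ∀ b c, inner ℝ (x - p b) (x - p c) = I b c := fun b c => by rw [← hI]
    simp only [h1, hI', Finset.sum_sub_distrib, Finset.sum_add_distrib, Finset.sum_const,
      nsmul_eq_mul, ← Finset.mul_sum]
    ring
  have hlower : (S.card : ℝ) * ((S.card - 1) * δ ^ 2) ≤ ∑ b ∈ S, ∑ c ∈ S, ‖p b - p c‖ ^ 2 := by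
    rw [← nsmul_eq_mul]
    refine Finset.card_nsmul_le_sum _ _ _ fun b hb => ?_
    have h2 : ((S.erase b).card : ℝ) = S.card - 1 := by
      rw [Finset.card_erase_of_mem hb, Nat.cast_sub hS.card_pos, Nat.cast_one]
    rw [← h2, ← nsmul_eq_mul]
    refine (Finset.card_nsmul_le_sum _ _ _ fun c hc => ?_).trans
      (Finset.sum_le_sum_of_subset_of_nonneg (Finset.erase_subset b S) fun _ _ _ => sq_nonneg _)
    rw [← dist_eq_norm]
    exact pow_le_pow_left₀ hδ (hp _ _ (Finset.ne_of_mem_erase hc).symm) 2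
  have h3 : (S.card : ℝ) * ((S.card - 1) * δ ^ 2)
      ≤ S.card * (2 * ∑ c ∈ S, ‖x - p c‖ ^ 2) := by
    nlinarith [sq_nonneg ‖∑ c ∈ S, (x - p c)‖]
  linarith [le_of_mul_le_mul_left h3 hcard]

/-- Group the points by their best action; the `k` cell sizes minus one add up to `card ι - k`. An
empty cell contributes a negative bound, which is harmless. -/
theorem le_sum_topLoss {ι : Type*} [Fintype ι] {d k : ℕ} (hk : 0 < k) {p : ι → Space d}
    {a δ : ℝ} (ha : 0 ≤ a) (hδ : 0 ≤ δ) (hp : ∀ b c, b ≠ c → δ ≤ dist (p b) (p c))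
    (x : Fin k → Space d) :
    a * (((Fintype.card ι : ℝ) - k) * (δ ^ 2 / 2)) ≤ ∑ c, topLoss (kMeansLoss a (p c)) x := by
  classical
  have : Nonempty (Fin k) := ⟨⟨0, hk⟩⟩
  choose σ hσ using fun c => exists_eq_ciInf_of_finite (f := fun j => kMeansLoss a (p c) (x j))
  have h1 : ∑ c, topLoss (kMeansLoss a (p c)) x
      = a * ∑ j, ∑ c with σ c = j, ‖x j - p c‖ ^ 2 := by
    have hσ' : ∀ c, topLoss (kMeansLoss a (p c)) x = a * ‖x (σ c) - p c‖ ^ 2 :=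
      fun c => (hσ c).symm
    simp only [hσ']
    rw [← Finset.mul_sum, ← Finset.sum_fiberwise Finset.univ σ]
    congr 1
    refine Finset.sum_congr rfl fun j _ => Finset.sum_congr rfl fun c hc => ?_
    rw [(Finset.mem_filter.1 hc).2]
  rw [h1]
  refine mul_le_mul_of_nonneg_left ?_ ha
  refine le_trans (le_of_eq ?_) (Finset.sum_le_sum fun j _ =>
    card_sub_one_mul_le_sum_dist_sq hδ hp (Finset.univ.filter fun c => σ c = j) (x j))
  have hcard := Finset.card_eq_sum_card_fiberwise (f := σ) (s := Finset.univ)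
    (t := Finset.univ) fun _ _ => Finset.mem_coe.2 (Finset.mem_univ _)
  rw [← Finset.sum_mul, Finset.sum_sub_distrib, ← Nat.cast_sum, ← hcard]
  simp

/-! ### Moments of a random walk over uniform index sequences. -/

section Expect

variable {ι : Type*} [Fintype ι]

theorem expect_fin_succ {T : ℕ} (G : (Fin (T + 1) → ι) → ℝ) :
    𝔼 i, G i = 𝔼 i : Fin T → ι, 𝔼 c, G (Fin.cons c i) := by
  rw [← Finset.expect_comm]
  calc 𝔼 i, G i = 𝔼 x : ι × (Fin T → ι), G (Fin.cons x.1 x.2) :=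
      (Fintype.expect_equiv (Fin.consEquiv fun _ => ι) _ _ fun _ => rfl).symm
    _ = _ := by rw [← Finset.univ_product_univ, Finset.expect_product]

variable [Nonempty ι]

/-- Swapping coordinate `t` with a fresh sample is an involution, so it preserves the uniform
average. -/
theorem expect_resample {T : ℕ} (t : Fin T) (G : (Fin T → ι) → ℝ) :
    𝔼 i, G i = 𝔼 i, 𝔼 c, G (Function.update i t c) := by
  let e : (Fin T → ι) × ι ≃ (Fin T → ι) × ι :=
    { toFun := fun x => (Function.update x.1 t x.2, x.1 t)
      invFun := fun x => (Function.update x.1 t x.2, x.1 t)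
      left_inv := fun x => by simp
      right_inv := fun x => by simp }
  calc 𝔼 i, G i = 𝔼 i, 𝔼 _c : ι, G i := by simp
    _ = 𝔼 x : (Fin T → ι) × ι, G x.1 := by
      rw [← Finset.univ_product_univ, Finset.expect_product]
    _ = 𝔼 x : (Fin T → ι) × ι, G (Function.update x.1 t x.2) :=
      (Fintype.expect_equiv e _ _ fun _ => rfl).symm
    _ = _ := by rw [← Finset.univ_product_univ, Finset.expect_product]

theorem expect_eval {T : ℕ} (t : Fin T) (φ : ι → ℝ) : 𝔼 i : Fin T → ι, φ (i t) = 𝔼 c, φ c := by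
  rw [expect_resample t]
  simp

variable {ξ : ι → ℝ} {q : ℝ}

theorem expect_sum_sq (h1 : 𝔼 c, ξ c = 0) (h2 : 𝔼 c, ξ c ^ 2 = q) (T : ℕ) :
    𝔼 i : Fin T → ι, (∑ t, ξ (i t)) ^ 2 = T * q := by
  induction T with
  | zero => simp
  | succ T ih =>
    have h : ∀ s : ℝ, 𝔼 c, (ξ c + s) ^ 2 = q + s ^ 2 := by
      intro s
      simp only [add_sq, Finset.expect_add_distrib, ← Finset.expect_mul, ← Finset.mul_expect, h1, h2]
      simp
    rw [expect_fin_succ]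
    simp only [Fin.sum_univ_succ, Fin.cons_zero, Fin.cons_succ, h, Finset.expect_add_distrib, ih]
    simp
    ring

theorem expect_sum_pow_four_le (h1 : 𝔼 c, ξ c = 0) (h2 : 𝔼 c, ξ c ^ 2 = q)
    (h3 : 𝔼 c, ξ c ^ 3 = 0) (h4 : 𝔼 c, ξ c ^ 4 = q) (T : ℕ) :
    𝔼 i : Fin T → ι, (∑ t, ξ (i t)) ^ 4 ≤ 3 * (T * q) ^ 2 + T * q := by
  induction T with
  | zero => simp
  | succ T ih =>
    have h : ∀ s : ℝ, 𝔼 c, (ξ c + s) ^ 4 = q + 6 * q * s ^ 2 + s ^ 4 := by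
      intro s
      have : ∀ c, (ξ c + s) ^ 4
          = ξ c ^ 4 + ξ c ^ 3 * (4 * s) + ξ c ^ 2 * (6 * s ^ 2) + ξ c * (4 * s ^ 3) + s ^ 4 := by
        intro c; ring
      simp only [this, Finset.expect_add_distrib, ← Finset.expect_mul, h1, h2, h3, h4]
      simp
      ring
    rw [expect_fin_succ]
    simp only [Fin.sum_univ_succ, Fin.cons_zero, Fin.cons_succ, h, Finset.expect_add_distrib,
      ← Finset.mul_expect, expect_sum_sq h1 h2]
    simp
    nlinarith [sq_nonneg q]

/-- A fourth moment comparable to the squared variance forces a large first absolute moment. The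
assumption `1 ≤ T * q` bounds the fourth moment by `4 * (T * q) ^ 2`. -/
theorem sqrt_le_expect_abs_sum (h1 : 𝔼 c, ξ c = 0) (h2 : 𝔼 c, ξ c ^ 2 = q)
    (h3 : 𝔼 c, ξ c ^ 3 = 0) (h4 : 𝔼 c, ξ c ^ 4 = q) {T : ℕ} (hT : 1 ≤ T * q) :
    Real.sqrt (T * q) / 2 ≤ 𝔼 i : Fin T → ι, |∑ t, ξ (i t)| := by
  set v := T * q with hv
  have hv0 : 0 < Real.sqrt v := Real.sqrt_pos.2 (by linarith)
  -- This `l` optimizes the bound that `hpt` gives for second moment `v` and fourth moment `4 * v ^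
  -- 2`.
  set l := 2 * Real.sqrt v with hl
  have hl0 : 0 < l := by positivity
  have hl2 : l ^ 2 = 4 * v := by rw [hl, mul_pow, Real.sq_sqrt (by linarith)]; norm_num
  have hpt : ∀ s : ℝ, s ^ 2 * (3 * l ^ 2) - s ^ 4 ≤ |s| * (2 * l ^ 3) := by
    intro s
    rw [← sq_abs s, ← Even.pow_abs (by decide : Even 4) s]
    have hs := abs_nonneg s
    -- The difference of the two sides is `|s| * (|s| - l) ^ 2 * (|s| + 2 * l)`.
    nlinarith [mul_nonneg hs (mul_nonneg (sq_nonneg (|s| - l)) (by positivity : 0 ≤ |s| + 2 * l))]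
  have hE := Finset.expect_le_expect (s := Finset.univ)
    fun (i : Fin T → ι) _ => hpt (∑ t, ξ (i t))
  rw [Finset.expect_sub_distrib, ← Finset.expect_mul, ← Finset.expect_mul,
    expect_sum_sq h1 h2] at hE
  have h4' := expect_sum_pow_four_le h1 h2 h3 h4 T
  rw [← hv] at h4' hE
  have h5 : 8 * v ^ 2 ≤ (𝔼 i : Fin T → ι, |∑ t, ξ (i t)|) * (2 * l ^ 3) := by
    rw [hl2] at hE
    nlinarith
  have h6 : 8 * v ^ 2 = l / 4 * (2 * l ^ 3) := by
    rw [show l / 4 * (2 * l ^ 3) = (l ^ 2) ^ 2 / 2 by ring, hl2]; ring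
  rw [h6] at h5
  have := le_of_mul_le_mul_right h5 (by positivity)
  rw [hl] at this
  linarith

end Expect

/-! ### The uniform distribution on the centres. -/

/-- `F` is arbitrary because actions may depend non-measurably on the history; a measurable
embedding of a finite discrete space makes this harmless. -/
theorem exists_measure_integral_pi_eq_expect {ι : Type*} [Fintype ι] [Nonempty ι] {d : ℕ}
    {p : ι → Space d} (hp : Function.Injective p) (T : ℕ) :
    ∃ μ : Measure (Space d), IsProbabilityMeasure μ ∧ μ (Set.range p)ᶜ = 0 ∧
      ∀ F : (Fin T → Space d) → ℝ,
        ∫ y, F y ∂Measure.pi (fun _ : Fin T => μ) = 𝔼 i : Fin T → ι, F fun t => p (i t) := by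
  let : MeasurableSpace ι := ⊤
  have : DiscreteMeasurableSpace ι := ⟨fun _ => trivial⟩
  let ν : Measure ι := (PMF.uniformOfFintype ι).toMeasure
  have hpm : Measurable p := measurable_from_top
  have hμ : IsProbabilityMeasure (ν.map p) := Measure.isProbabilityMeasure_map hpm.aemeasurable
  refine ⟨ν.map p, hμ, ?_, fun F => ?_⟩
  · rw [Measure.map_apply hpm (Set.finite_range p).measurableSet.compl]
    simp
  · have hemb : MeasurableEmbedding fun (i : Fin T → ι) t => p (i t) :=
      { injective := fun i j h => funext fun t => hp (congrFun h t)
        measurable := measurable_pi_lambda _ fun t => hpm.comp (measurable_pi_apply t)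
        measurableSet_image' := fun s _ => (s.toFinite.image _).measurableSet }
    rw [← Measure.pi_map_pi fun _ => hpm.aemeasurable, hemb.integral_map,
      integral_fintype .of_finite, Fintype.expect_eq_sum_div_card, Finset.sum_div]
    refine Finset.sum_congr rfl fun i _ => ?_
    have hν : ∀ c, ν.real {c} = (Fintype.card ι : ℝ)⁻¹ := by
      intro c
      rw [measureReal_def, PMF.toMeasure_apply_singleton _ _ (measurableSet_singleton c)]
      simp
    have hi : (Measure.pi fun _ : Fin T => ν).real {i} = ((Fintype.card ι : ℝ) ^ T)⁻¹ := by
      rw [measureReal_def, Measure.pi_singleton, ENNReal.toReal_prod]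
      simp only [← measureReal_def, hν]
      simp
    rw [hi, smul_eq_mul]
    simp [div_eq_inv_mul]

/-! ### Upper bound for the best tuple in hindsight. -/

theorem bestStaticLoss_le {κ : Type*} [Fintype κ] {d k T : ℕ} (hκ : Fintype.card κ = k)
    {a : ℝ} (ha : 0 ≤ a) {y : Fin T → Space d} {x : κ → Space d} (hx : ∀ j, x j ∈ unitBall d)
    {w : Fin T → ℝ} (hw : ∀ t, ∃ j, ‖x j - y t‖ ^ 2 ≤ w t) :
    bestStaticLoss k (fun t => kMeansLoss a (y t)) ≤ a * ∑ t, w t := by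
  have hpos : ∀ t z, 0 ≤ kMeansLoss a (y t) z := fun t z => by unfold kMeansLoss; positivity
  let σ : Fin k ≃ κ := (Fintype.equivFinOfCardEq hκ).symm
  refine (ciInf_le ⟨0, ?_⟩ fun j => ⟨x (σ j), hx _⟩).trans ?_
  · rintro _ ⟨z, rfl⟩
    exact Finset.sum_nonneg fun t _ => Real.iInf_nonneg fun j => hpos _ _
  · rw [Finset.mul_sum]
    refine Finset.sum_le_sum fun t _ => ?_
    obtain ⟨j, hj⟩ := hw t
    refine (ciInf_le ⟨0, ?_⟩ (σ.symm j)).trans ?_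
    · rintro _ ⟨z, rfl⟩
      exact hpos _ _
    · simpa [kMeansLoss] using mul_le_mul_of_nonneg_left hj ha

/-- The indicator function of the triple `g`. -/
def tripleIndicator {m e : ℕ} (g : Fin m) : Label m e → ℝ :=
  Sum.elim (fun c => if c.1 = g then 1 else 0) 0

/-- The function that is `1` at the first point of the triple `g`, `-1` at its last point and `0`
elsewhere. -/
def endSign {m e : ℕ} (g : Fin m) : Label m e → ℝ :=
  Sum.elim (fun c => if c.1 = g then 1 - ((c.2 : ℕ) : ℝ) else 0) 0

section Triples

variable {d m e : ℕ} {p : Label m e → Space d} {a δ : ℝ}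

theorem bestStaticLoss_triples_le {T : ℕ} (ha : 0 ≤ a) (hball : ∀ c, p c ∈ unitBall d)
    (hdist : ∀ g, dist (p (.inl (g, 0))) (p (.inl (g, 1))) = δ ∧
      dist (p (.inl (g, 1))) (p (.inl (g, 2))) = δ) (i : Fin T → Label m e) :
    bestStaticLoss (2 * m + e) (fun t => kMeansLoss a (p (i t)))
      ≤ a * (δ ^ 2 / 4 * ∑ g : Fin m,
          ((∑ t, (tripleIndicator g (i t) - endSign g (i t) ^ 2 / 2))
            - |∑ t, endSign g (i t)| / 2)) := by
  classical
  let S : Fin m → ℝ := fun g => ∑ t, endSign g (i t)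
  let b : Fin m → Prop := fun g => 0 ≤ S g
  let σ : Fin m → ℝ := fun g => if b g then 1 else -1
  have hσ : ∀ g, |S g| = σ g * S g := by
    intro g
    by_cases h : 0 ≤ S g
    · simp [σ, b, h, abs_of_nonneg h]
    · simp [σ, b, h, abs_of_neg (not_le.1 h)]
  -- `true` labels the action at the more frequent end, `false` the one at the midpoint of the other
  -- two points.
  let x : (Fin m × Bool) ⊕ Fin e → Space d :=
    Sum.elim (fun j => if j.2 then p (.inl (j.1, if b j.1 then 0 else 2))
      else midpoint ℝ (p (.inl (j.1, 1))) (p (.inl (j.1, if b j.1 then 2 else 0))))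
      fun s => p (.inr s)
  have hx : ∀ j, x j ∈ unitBall d := by
    rintro (⟨g, _ | _⟩ | s)
    · exact (convex_closedBall (0 : Space d) 1).midpoint_mem (hball _) (hball _)
    · exact hball _
    · exact hball _
  -- The loss in closed form: `0` at the chosen end and at single points, `δ ^ 2 / 4` at the other
  -- two points of a triple.
  let w : Label m e → ℝ := fun c =>
    δ ^ 2 / 4 * ∑ g, (tripleIndicator g c - endSign g c ^ 2 / 2 - σ g * endSign g c / 2)
  have hwl : ∀ g j, w (.inl (g, j))
      = δ ^ 2 / 4 * (1 - (1 - (j : ℕ)) ^ 2 / 2 - σ g * (1 - (j : ℕ)) / 2) := by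
    intro g j
    simp only [w]
    rw [Finset.sum_eq_single g]
    · simp [tripleIndicator, endSign]
    · intro g' _ hg'
      simp [tripleIndicator, endSign, hg'.symm]
    · simp
  have hmid : ∀ u v : Space d, dist u v = δ →
      ‖midpoint ℝ u v - u‖ ^ 2 = δ ^ 2 / 4 ∧ ‖midpoint ℝ u v - v‖ ^ 2 = δ ^ 2 / 4 := by
    intro u v huv
    rw [← dist_eq_norm, ← dist_eq_norm, dist_midpoint_left, dist_midpoint_right, huv]
    norm_num
    ring
  have hw : ∀ t, ∃ j, ‖x j - p (i t)‖ ^ 2 ≤ w (i t) := by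
    intro t
    rcases i t with ⟨g, j⟩ | s
    · have h12 := hmid _ _ (hdist g).2
      have h10 := hmid _ _ ((dist_comm _ _).trans (hdist g).1)
      rw [hwl]
      by_cases hb : b g
      · have hxs : x (.inl (g, true)) = p (.inl (g, 0)) := by simp only [x, hb, if_true, Sum.elim_inl]
        have hxm : x (.inl (g, false)) = midpoint ℝ (p (.inl (g, 1))) (p (.inl (g, 2))) := by
          simp only [x, hb, if_true, Sum.elim_inl, reduceCtorEq, if_false]
        have hσg : σ g = 1 := if_pos hb
        rw [hσg]
        fin_cases j
        · exact ⟨.inl (g, true), by rw [hxs]; norm_num⟩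
        · exact ⟨.inl (g, false), by rw [hxm]; exact h12.1.le.trans (by norm_num)⟩
        · exact ⟨.inl (g, false), by rw [hxm]; exact h12.2.le.trans (by norm_num)⟩
      · have hxs : x (.inl (g, true)) = p (.inl (g, 2)) := by
          simp only [x, hb, if_true, Sum.elim_inl, if_false]
        have hxm : x (.inl (g, false)) = midpoint ℝ (p (.inl (g, 1))) (p (.inl (g, 0))) := by
          simp only [x, hb, Sum.elim_inl, reduceCtorEq, if_false]
        have hσg : σ g = -1 := if_neg hb
        rw [hσg]
        fin_cases j
        · exact ⟨.inl (g, false), by rw [hxm]; exact h10.2.le.trans (by norm_num)⟩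
        · exact ⟨.inl (g, false), by rw [hxm]; exact h10.1.le.trans (by norm_num)⟩
        · exact ⟨.inl (g, true), by simp only [hxs, Fin.reduceFinMk, sub_self]; norm_num⟩
    · exact ⟨.inr s, by simp [x, w, tripleIndicator, endSign]⟩
  refine (bestStaticLoss_le (by simp [mul_comm]) ha hx hw).trans_eq ?_
  congr 1
  simp only [w]
  rw [← Finset.mul_sum, Finset.sum_comm]
  congr 1
  refine Finset.sum_congr rfl fun g _ => ?_
  change _ = _ - |S g| / 2
  rw [Finset.sum_sub_distrib, hσ, ← Finset.sum_div, ← Finset.mul_sum]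

theorem sum_label (φ : Label m e → ℝ) (g : Fin m) (hφ : ∀ c, tripleIndicator g c = 0 → φ c = 0) :
    ∑ c, φ c = φ (.inl (g, 0)) + φ (.inl (g, 1)) + φ (.inl (g, 2)) := by
  rw [Fintype.sum_sum_type, Fintype.sum_prod_type, Finset.sum_eq_single g, Fin.sum_univ_three,
    Finset.sum_eq_zero, add_zero]
  · intro c _
    exact hφ _ rfl
  · intro g' _ hg'
    exact Finset.sum_eq_zero fun j _ => hφ _ (by simp [tripleIndicator, hg'])
  · simp

theorem endSign_eq_zero {g : Fin m} {c : Label m e} (h : tripleIndicator g c = 0) :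
    endSign g c = 0 := by
  rcases c with c | c
  · simp only [tripleIndicator, Sum.elim_inl, ite_eq_right_iff, one_ne_zero, imp_false] at h
    simp [endSign, h]
  · rfl

theorem card_label : (Fintype.card (Label m e) : ℝ) = 3 * m + e := by
  simp [mul_comm]

theorem expect_endSign_pow (g : Fin m) {n : ℕ} (hn : n ≠ 0) :
    𝔼 c : Label m e, endSign g c ^ n = (1 + (-1) ^ n) / (3 * m + e) := by
  rw [Fintype.expect_eq_sum_div_card, card_label,
    sum_label _ g fun c hc => by rw [endSign_eq_zero hc, zero_pow hn]]
  norm_num [endSign, hn]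

theorem expect_tripleIndicator (g : Fin m) :
    𝔼 c : Label m e, tripleIndicator g c = 3 / (3 * m + e) := by
  rw [Fintype.expect_eq_sum_div_card, card_label, sum_label _ g fun c hc => hc]
  norm_num [tripleIndicator]

theorem expect_bestStaticLoss_triples_le {T : ℕ} (hm : 0 < m) (hT : 2 * m + e ≤ T) (ha : 0 ≤ a)
    (hball : ∀ c, p c ∈ unitBall d)
    (hdist : ∀ g, dist (p (.inl (g, 0))) (p (.inl (g, 1))) = δ ∧
      dist (p (.inl (g, 1))) (p (.inl (g, 2))) = δ) :
    𝔼 i : Fin T → Label m e, bestStaticLoss (2 * m + e) (fun t => kMeansLoss a (p (i t)))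
      ≤ a * (δ ^ 2 / 4 * (m * (T * (2 / (3 * m + e))
          - Real.sqrt (T * (2 / (3 * m + e))) / 4))) := by
  have : Nonempty (Label m e) := ⟨.inl (⟨0, hm⟩, 0)⟩
  refine (Finset.expect_le_expect fun i _ => bestStaticLoss_triples_le ha hball hdist i).trans ?_
  rw [← Finset.mul_expect, ← Finset.mul_expect, Finset.expect_sum_comm]
  refine mul_le_mul_of_nonneg_left (mul_le_mul_of_nonneg_left ?_ (by positivity)) ha
  refine (Finset.sum_le_card_nsmul Finset.univ _ (T * (2 / (3 * m + e) : ℝ)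
      - Real.sqrt (T * (2 / (3 * m + e))) / 4) fun g _ => ?_).trans_eq
    (by rw [Finset.card_univ, Fintype.card_fin, nsmul_eq_mul])
  rw [Finset.expect_sub_distrib, Finset.expect_sum_comm, ← Finset.expect_div]
  have h2 := expect_endSign_pow (e := e) g two_ne_zero
  have hq : (1 + (-1) ^ 2 : ℝ) / (3 * m + e) = 2 / (3 * m + e) := by norm_num
  have hM : (0 : ℝ) < 3 * m + e := by positivity
  -- Here `T ≥ k` matters: `2T ≥ 4m + 2e ≥ 3m + e`.
  have hTq : (1 : ℝ) ≤ T * (2 / (3 * m + e)) := by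
    rw [← mul_div_assoc, one_le_div hM]
    have : (2 * m + e : ℝ) ≤ T := by exact_mod_cast hT
    linarith [(Nat.cast_nonneg m : (0 : ℝ) ≤ m), (Nat.cast_nonneg e : (0 : ℝ) ≤ e)]
  have habs := sqrt_le_expect_abs_sum (ξ := endSign (e := e) g)
    (by simpa using expect_endSign_pow (e := e) g one_ne_zero) (h2.trans hq)
    ((expect_endSign_pow (e := e) g three_ne_zero).trans (by norm_num))
    ((expect_endSign_pow g four_ne_zero).trans (by norm_num)) hTq
  have hsum : ∑ t : Fin T, 𝔼 i : Fin T → Label m e,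
      (tripleIndicator g (i t) - endSign g (i t) ^ 2 / 2) = (T : ℝ) * (2 / (3 * m + e)) := by
    have h : ∀ t : Fin T, 𝔼 i : Fin T → Label m e,
        (tripleIndicator g (i t) - endSign g (i t) ^ 2 / 2) = (2 : ℝ) / (3 * m + e) := by
      intro t
      rw [expect_eval t fun c => tripleIndicator g c - endSign g c ^ 2 / 2,
        Finset.expect_sub_distrib, ← Finset.expect_div, expect_tripleIndicator, h2]
      ring
    simp [h]
  rw [hsum]
  linarith

end Triples

/-! ### Lower bound for the loss of an algorithm. -/

section Algorithm

variable {d k : ℕ} {a : ℝ}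

theorem kMeansLoss_mem_Icc (ha : 0 ≤ a) {x y : Space d} (hx : x ∈ unitBall d)
    (hy : y ∈ unitBall d) : kMeansLoss a y x ∈ Set.Icc 0 (a * 2 ^ 2) := by
  simp only [unitBall, mem_closedBall_zero_iff] at hx hy
  have : ‖x - y‖ ≤ 2 := (norm_sub_le x y).trans (by linarith)
  unfold kMeansLoss
  exact ⟨by positivity, by gcongr⟩

theorem RandomizedAlgorithm.integrable_topLoss (A : RandomizedAlgorithm.{u} d k) (hk : 0 < k)
    (ha : 0 ≤ a) {y : Space d} (hy : y ∈ unitBall d) (t : ℕ) (h : Fin t → Loss d) :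
    Integrable (fun ω => topLoss (kMeansLoss a y) (A.action t h ω)) A.P := by
  have : Nonempty (Fin k) := ⟨⟨0, hk⟩⟩
  have hmem := fun ω j => kMeansLoss_mem_Icc ha (A.action_mem t h ω j) hy
  refine Integrable.of_mem_Icc 0 (a * 2 ^ 2) (Measurable.aemeasurable ?_) (ae_of_all _ fun ω => ?_)
  · refine Measurable.iInf fun j => ?_
    exact (((A.measurable_action t h j).sub_const y).norm.pow_const 2).const_mul a
  · exact ⟨le_ciInf fun j => (hmem ω j).1,
      (ciInf_le ⟨0, by rintro _ ⟨j, rfl⟩; exact (hmem ω j).1⟩ ⟨0, hk⟩).trans (hmem ω _).2⟩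

theorem RandomizedAlgorithm.expectedRegret_kMeansLoss (A : RandomizedAlgorithm.{u} d k)
    (hk : 0 < k) (ha : 0 ≤ a) {T : ℕ} {y : Fin T → Space d} (hy : ∀ t, y t ∈ unitBall d) :
    A.expectedRegret (fun t => kMeansLoss a (y t))
      = (∑ t : Fin T, ∫ ω, topLoss (kMeansLoss a (y t))
          (A.action t (history (fun t => kMeansLoss a (y t)) t) ω) ∂A.P)
        - bestStaticLoss k (fun t => kMeansLoss a (y t)) := by
  have hint := fun t : Fin T => A.integrable_topLoss hk ha (hy t) t
    (history (fun t => kMeansLoss a (y t)) t)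
  unfold expectedRegret regret
  rw [integral_sub (integrable_finsetSum _ fun t _ => hint t) (integrable_const _),
    integral_finsetSum _ fun t _ => hint t]
  simp

/-- Resampling the centre of round `t` leaves the history, hence the action, unchanged;
`le_sum_topLoss` then applies for each `ω`. -/
theorem RandomizedAlgorithm.le_expect_integral_topLoss {ι : Type*} [Fintype ι] [Nonempty ι]
    (A : RandomizedAlgorithm.{u} d k) (hk : 0 < k) (ha : 0 ≤ a) {p : ι → Space d} {δ : ℝ}
    (hδ : 0 ≤ δ) (hball : ∀ c, p c ∈ unitBall d)
    (hp : ∀ b c, b ≠ c → δ ≤ dist (p b) (p c)) {T : ℕ} (t : Fin T) :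
    a * (((Fintype.card ι : ℝ) - k) * (δ ^ 2 / 2)) / Fintype.card ι
      ≤ 𝔼 i : Fin T → ι, ∫ ω, topLoss (kMeansLoss a (p (i t)))
          (A.action t (history (fun t => kMeansLoss a (p (i t))) t) ω) ∂A.P := by
  rw [expect_resample t]
  refine Finset.le_expect Finset.univ_nonempty fun i _ => ?_
  have hhist : ∀ c, history (fun s => kMeansLoss a (p (Function.update i t c s))) t
      = history (fun s => kMeansLoss a (p (i s))) t := by
    intro c
    funext s
    have hs : Fin.castLE t.isLt.le s ≠ t := fun h => s.isLt.ne (congrArg Fin.val h)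
    simp [history, Function.update_of_ne hs]
  simp only [hhist, Function.update_self]
  rw [Fintype.expect_eq_sum_div_card, ← integral_finsetSum _ fun c _ =>
    A.integrable_topLoss hk ha (hball c) t _]
  refine div_le_div_of_nonneg_right ?_ (Nat.cast_nonneg _)
  have hconst : a * (((Fintype.card ι : ℝ) - k) * (δ ^ 2 / 2))
      = ∫ _, a * (((Fintype.card ι : ℝ) - k) * (δ ^ 2 / 2)) ∂A.P := by simp
  rw [hconst]
  exact integral_mono (integrable_const _)
    (integrable_finsetSum _ fun c _ => A.integrable_topLoss hk ha (hball c) t _)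
    fun ω => le_sum_topLoss hk ha hδ hp _

end Algorithm

/-! ### Combining the bounds and choosing the scale. -/

theorem RandomizedAlgorithm.le_expect_expectedRegret {d m e T : ℕ} {p : Label m e → Space d}
    {a δ : ℝ} (A : RandomizedAlgorithm.{u} d (2 * m + e)) (hm : 0 < m) (he : e ≤ 1)
    (hT : 2 * m + e ≤ T) (ha : 0 ≤ a) (hδ : 0 ≤ δ) (hball : ∀ c, p c ∈ unitBall d)
    (hp : ∀ b c, b ≠ c → δ ≤ dist (p b) (p c))
    (hdist : ∀ g, dist (p (.inl (g, 0))) (p (.inl (g, 1))) = δ ∧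
      dist (p (.inl (g, 1))) (p (.inl (g, 2))) = δ) :
    a * δ ^ 2 / 48 * Real.sqrt ((2 * m + e : ℕ) * T)
      ≤ 𝔼 i : Fin T → Label m e, A.expectedRegret (fun t => kMeansLoss a (p (i t))) := by
  have : Nonempty (Label m e) := ⟨.inl (⟨0, hm⟩, 0)⟩
  have hk : 0 < 2 * m + e := by omega
  simp only [A.expectedRegret_kMeansLoss hk ha fun t => hball _]
  rw [Finset.expect_sub_distrib, Finset.expect_sum_comm]
  have hplay := Finset.card_nsmul_le_sum Finset.univ _ _ fun (t : Fin T) _ =>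
    A.le_expect_integral_topLoss hk ha hδ hball hp t
  have hbest := expect_bestStaticLoss_triples_le hm hT ha hball hdist
  rw [card_label, Finset.card_univ, Fintype.card_fin, nsmul_eq_mul] at hplay
  have hm1 : (1 : ℝ) ≤ m := by exact_mod_cast hm
  have he1 : (e : ℝ) ≤ 1 := by exact_mod_cast he
  have he0 : (0 : ℝ) ≤ e := Nat.cast_nonneg e
  have hT0 : (0 : ℝ) ≤ T := Nat.cast_nonneg T
  have hM : (0 : ℝ) < 3 * m + e := by positivity
  have hroot : Real.sqrt ((2 * m + e : ℕ) * T) / 3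
      ≤ m * Real.sqrt (T * (2 / (3 * m + e))) := by
    refine le_of_sq_le_sq ?_ (by positivity)
    rw [div_pow, mul_pow, Real.sq_sqrt (by positivity), Real.sq_sqrt (by positivity)]
    push_cast
    rw [show (m : ℝ) ^ 2 * (T * (2 / (3 * m + e))) = 2 * m ^ 2 * T / (3 * m + e) by ring,
      div_le_div_iff₀ (by norm_num) hM]
    have : (2 * m + e) * (3 * m + e) ≤ (18 * m ^ 2 : ℝ) := by nlinarith
    nlinarith
  have hgain : a * δ ^ 2 / 16 * (Real.sqrt ((2 * m + e : ℕ) * T) / 3)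
      ≤ a * δ ^ 2 / 16 * (m * Real.sqrt (T * (2 / (3 * m + e)))) :=
    mul_le_mul_of_nonneg_left hroot (by positivity)
  -- The terms linear in `T` cancel exactly, leaving only the square-root gain.
  have heq : (T : ℝ) * (a * ((3 * m + e - (2 * m + e : ℕ)) * (δ ^ 2 / 2)) / (3 * m + e))
      = a * (δ ^ 2 / 4 * (m * (T * (2 / (3 * m + e))))) := by
    push_cast
    field_simp
    ring
  rw [heq] at hplay
  linarith

theorem exists_hard_centres {k d : ℕ} (hk : 2 ≤ k) (hd : 6 ≤ d) :
    ∃ (ι : Type) (_ : Fintype ι) (_ : Nonempty ι) (p : ι → Space d), Function.Injective p ∧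
      (∀ c, p c ∈ unitBall d) ∧
      ∀ (T : ℕ) (a : ℝ) (A : RandomizedAlgorithm.{u} d k), k ≤ T → 0 < a →
        1 / 768 * a * (k : ℝ) ^ (-2 / ((d : ℝ) - 1)) * Real.sqrt ((k : ℝ) * (T : ℝ))
          ≤ 𝔼 i : Fin T → ι, A.expectedRegret fun t => kMeansLoss a (p (i t)) := by
  obtain ⟨m, e, rfl, he⟩ : ∃ m e, k = 2 * m + e ∧ e ≤ 1 := ⟨k / 2, k % 2, by omega, by omega⟩
  have hm : 0 < m := by omega
  set k := 2 * m + e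
  have hk0 : (0 : ℝ) < k := by positivity
  have hk1 : (1 : ℝ) ≤ k := by exact_mod_cast (by omega : 1 ≤ k)
  have hd1 : (0 : ℝ) < (d : ℝ) - 1 := by
    have : (6 : ℝ) ≤ d := by exact_mod_cast hd
    linarith
  set r : ℝ := (k : ℝ) ^ (-1 / ((d : ℝ) - 1)) with hr
  have hr0 : 0 < r := Real.rpow_pos_of_pos hk0 _
  have hr1 : r ≤ 1 := Real.rpow_le_one_of_one_le_of_nonpos hk1
    (div_nonpos_of_nonpos_of_nonneg (by norm_num) hd1.le)
  have hr2 : r ^ 2 = (k : ℝ) ^ (-2 / ((d : ℝ) - 1)) := by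
    rw [hr, ← Real.rpow_mul_natCast hk0.le]
    congr 1
    push_cast
    ring
  have hrd : k * r ^ d ≤ 1 := by
    rw [hr, ← Real.rpow_mul_natCast hk0.le]
    nth_rewrite 1 [← Real.rpow_one (k : ℝ)]
    rw [← Real.rpow_add hk0]
    refine Real.rpow_le_one_of_one_le_of_nonpos hk1 ?_
    rw [div_mul_eq_mul_div, ← sub_nonneg]
    have : (0 : ℝ) - (1 + -1 * d / (d - 1)) = 1 / (d - 1) := by field_simp; ring
    rw [this]
    positivity
  -- With `δ = r / 4`, packing reduces to `k * r ^ d ≤ 1`. This `δ` turns `1 / 48` into `1 / 768`.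
  have hpack : ((m + e : ℕ) : ℝ) * (3 * (r / 4)) ^ d ≤ (1 - r / 4) ^ d := by
    calc ((m + e : ℕ) : ℝ) * (3 * (r / 4)) ^ d = (m + e : ℕ) * r ^ d * (3 / 4) ^ d := by
          rw [mul_assoc, ← mul_pow]; congr 2; ring
      _ ≤ 1 * (3 / 4) ^ d := by
          refine mul_le_mul_of_nonneg_right (le_trans ?_ hrd) (by positivity)
          exact mul_le_mul_of_nonneg_right (by exact_mod_cast (by omega : m + e ≤ k))
            (by positivity)
      _ ≤ (1 - r / 4) ^ d := by
          rw [one_mul]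
          exact pow_le_pow_left₀ (by norm_num) (by linarith) d
  obtain ⟨p, hball, hp, hdist⟩ := exists_separated_triples (by omega : 0 < d)
    (by positivity : 0 < r / 4) (by linarith) hpack
  refine ⟨Label m e, inferInstance, ⟨.inl (⟨0, hm⟩, 0)⟩, p, fun b c hbc => ?_, hball,
    fun T a A hT ha => ?_⟩
  · by_contra hne
    have := hp b c hne
    rw [hbc, dist_self] at this
    linarith
  · refine le_trans (le_of_eq ?_)
      (A.le_expect_expectedRegret hm he hT ha.le (by positivity) hball hp hdist)
    rw [← hr2]
    ring

/-! ### Excluding logarithmic regret. -/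

theorem lipschitzOnWith_kMeansLoss {d : ℕ} {y : Space d} (hy : y ∈ unitBall d) :
    LipschitzOnWith 1 (kMeansLoss (1 / 4) y) (unitBall d) := by
  refine LipschitzOnWith.of_dist_le_mul fun x hx z hz => ?_
  simp only [unitBall, mem_closedBall_zero_iff] at hx hy hz
  have h1 : ‖x - y‖ ≤ 2 := (norm_sub_le x y).trans (by linarith)
  have h2 : ‖z - y‖ ≤ 2 := (norm_sub_le z y).trans (by linarith)
  have h3 : |‖x - y‖ - ‖z - y‖| ≤ ‖x - z‖ := by
    simpa using abs_norm_sub_norm_le (x - y) (z - y)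
  have h4 : kMeansLoss (1 / 4) y x - kMeansLoss (1 / 4) y z
      = (‖x - y‖ - ‖z - y‖) * ((‖x - y‖ + ‖z - y‖) / 4) := by
    unfold kMeansLoss
    ring
  rw [Real.dist_eq, h4, abs_mul, abs_of_nonneg (by positivity : 0 ≤ (‖x - y‖ + ‖z - y‖) / 4),
    dist_eq_norm, NNReal.coe_one, one_mul]
  calc |‖x - y‖ - ‖z - y‖| * ((‖x - y‖ + ‖z - y‖) / 4) ≤ ‖x - z‖ * 1 := by
        gcongr
        linarith
    _ = ‖x - z‖ := mul_one _

theorem strongConvexOn_kMeansLoss {d : ℕ} (y : Space d) :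
    StrongConvexOn (unitBall d) (1 / 2) (kMeansLoss (1 / 4) y) := by
  rw [strongConvexOn_iff_convex]
  -- Subtracting the quadratic part leaves an affine function.
  have h : (fun x => kMeansLoss (1 / 4) y x - 1 / 2 / (2 : ℝ) * ‖x‖ ^ 2)
      = fun x => (-(1 / 2 : ℝ) • innerₛₗ ℝ y) x + 1 / 4 * ‖y‖ ^ 2 := by
    funext x
    simp only [kMeansLoss, norm_sub_sq_real, LinearMap.smul_apply, innerₛₗ_apply_apply,
      smul_eq_mul, real_inner_comm y x]
    ring
  rw [h]
  exact (LinearMap.convexOn _ (convex_closedBall _ _)).add_const _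

theorem exists_natCast_log_lt_sqrt {b : ℝ} (hb : 0 < b) (C : ℝ) (N : ℕ) :
    ∃ T : ℕ, N ≤ T ∧ C * Real.log T < b * Real.sqrt T := by
  have hlog : Filter.Tendsto (fun T : ℕ => Real.log T / Real.sqrt T) Filter.atTop (nhds 0) := by
    simp only [Real.sqrt_eq_rpow]
    exact (isLittleO_log_rpow_atTop (by norm_num : (0 : ℝ) < 1 / 2)).tendsto_div_nhds_zero.comp
      tendsto_natCast_atTop_atTop
  have hlim : Filter.Tendsto (fun T : ℕ => C * (Real.log T / Real.sqrt T)) Filter.atTop (nhds 0) := by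
    simpa using hlog.const_mul C
  obtain ⟨T, hT, hNT⟩ := ((hlim.eventually_lt_const hb).and
    (Filter.eventually_ge_atTop (max N 1))).exists
  have hT1 : (0 : ℝ) < T := by exact_mod_cast (le_of_max_le_right hNT)
  refine ⟨T, le_of_max_le_left hNT, ?_⟩
  rwa [← mul_div_assoc, div_lt_iff₀ (Real.sqrt_pos.2 hT1)] at hT

theorem exists_hard_sequence {k d T : ℕ} (hk : 2 ≤ k) (hd : 6 ≤ d) (hT : k ≤ T) {a : ℝ}
    (ha : 0 < a) (A : RandomizedAlgorithm.{u} d k) :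
    ∃ y : Fin T → Space d, (∀ t, y t ∈ unitBall d) ∧
      1 / 768 * a * (k : ℝ) ^ (-2 / ((d : ℝ) - 1)) * Real.sqrt ((k : ℝ) * (T : ℝ))
        ≤ A.expectedRegret fun t => kMeansLoss a (y t) := by
  obtain ⟨ι, _, _, p, _, hball, hp⟩ := exists_hard_centres.{u} hk hd
  obtain ⟨i, _, hi⟩ := Finset.exists_le_of_le_expect Finset.univ_nonempty (hp T a A hT ha)
  exact ⟨fun t => p (i t), fun t => hball _, hi⟩

end TopK

theorem mainTheorem8 :
    (∃ c : ℝ, 0 < c ∧ ∀ k d T : ℕ, 2 ≤ k → 6 ≤ d → k ≤ T → ∀ a : ℝ, 0 < a →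
      -- one finitely supported distribution of the centres, known to the algorithm
      (∃ μ : Measure (TopK.Space d), IsProbabilityMeasure μ ∧
        (∃ S : Set (TopK.Space d), S.Finite ∧ S ⊆ TopK.unitBall d ∧ μ Sᶜ = 0) ∧
        ∀ A : TopK.RandomizedAlgorithm.{u} d k,
          c * a * (k : ℝ) ^ (-2 / ((d : ℝ) - 1)) * Real.sqrt ((k : ℝ) * (T : ℝ))
            ≤ A.stochasticRegret T a μ) ∧
      -- worst-case fixed sequences of centres
      (∀ A : TopK.RandomizedAlgorithm.{u} d k,
        ∃ y : Fin T → TopK.Space d, (∀ t, y t ∈ TopK.unitBall d) ∧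
          c * a * (k : ℝ) ^ (-2 / ((d : ℝ) - 1)) * Real.sqrt ((k : ℝ) * (T : ℝ))
            ≤ A.expectedRegret fun t => TopK.kMeansLoss a (y t))) ∧
    -- no logarithmic regret for strongly convex losses
    (∀ k d : ℕ, 2 ≤ k → 6 ≤ d → ∀ A : ℕ → TopK.RandomizedAlgorithm.{u} d k,
      ¬ ∃ (C : ℝ) (T₀ : ℕ), ∀ T : ℕ, T₀ ≤ T → ∀ f : Fin T → TopK.Loss d,
        (∀ t, LipschitzOnWith 1 (f t) (TopK.unitBall d) ∧
          StrongConvexOn (TopK.unitBall d) (1 / 2) (f t)) →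
        (A T).expectedRegret f ≤ C * Real.log (T : ℝ)) := by
  refine ⟨⟨1 / 768, by norm_num, fun k d T hk hd hT a ha => ⟨?_, fun A =>
    TopK.exists_hard_sequence hk hd hT ha A⟩⟩, ?_⟩
  · obtain ⟨ι, _, _, p, hpinj, hball, hp⟩ := TopK.exists_hard_centres.{u} hk hd
    obtain ⟨μ, hμ, hμp, hint⟩ := TopK.exists_measure_integral_pi_eq_expect hpinj T
    refine ⟨μ, hμ, ⟨Set.range p, Set.finite_range p, Set.range_subset_iff.2 hball, hμp⟩,
      fun A => ?_⟩
    rw [TopK.RandomizedAlgorithm.stochasticRegret, hint]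
    exact hp T a A hT ha
  · rintro k d hk hd A ⟨C, T₀, hC⟩
    have hk0 : (0 : ℝ) < k := by exact_mod_cast (by omega : 0 < k)
    obtain ⟨T, hNT, hT⟩ := TopK.exists_natCast_log_lt_sqrt
      (by positivity : 0 < 1 / 768 * (1 / 4) * (k : ℝ) ^ (-2 / ((d : ℝ) - 1)) * Real.sqrt k)
      C (max k T₀)
    obtain ⟨y, hy, hreg⟩ := TopK.exists_hard_sequence (T := T) hk hd (le_of_max_le_left hNT)
      (by norm_num : (0 : ℝ) < 1 / 4) (A T)
    have hlog := hC T (le_of_max_le_right hNT) _ fun t =>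
      ⟨TopK.lipschitzOnWith_kMeansLoss (hy t), TopK.strongConvexOn_kMeansLoss (y t)⟩
    rw [Real.sqrt_mul hk0.le, ← mul_assoc] at hreg
    linarith
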